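/- A signed permutation of order $n$ is a list $\alpha=[a_1,\dots,a_n]$ of nonzero integers whose absolute values are $1,\dots,n$ in some order. The pointers of an entry $a$ are its tail $(|a|-1,|a|)$ and its head $(|a|,|a|+1)$; if $a>0$ the tail is written on the left and the head on the right of $a$, and if $a<0$ the head is written on the left and the tail on the right. An application of $\mathrm{cdr}$ at a pointer $p$ is possible if the two occurrences of $p$ are in entries of opposite signs (equivalently, both are on the left or both are on the right of their entries); it reverses the order, and changes the signs, of all the entries between the two occurrences of $p$. An application of $\mathrm{cds}$ at a pair of pointers $p,q$ is possible if their occurrences appear in the order $p\dots q\dots p\dots q$ and each of $p$ and $q$ occurs in two entries of the same sign; it interchanges the block of entries between the first $p$ and the first $q$ with the block between the second $p$ and the second $q$. A fixed point of $\mathrm{cdr}$ (of $\mathrm{cds}$) is a signed permutation to which no application of $\mathrm{cdr}$ (of $\mathrm{cds}$) is possible. A signed permutation of order $n$ is $\mathrm{cdr}$-sortable if finitely many applications of $\mathrm{cdr}$ transform it into the identity $[1,2,\dots,n]$. Theorem (cdr Steps Theorem). Let $\pi$ be a $\mathrm{cdr}$-sortable signed permutation. (1) Suppose that exactly $k$ successive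 applications of $\mathrm{cdr}$ transform $\pi$ into a fixed point $\beta$ of $\mathrm{cdr}$, and that exactly $m$ successive applications of $\mathrm{cds}$ transform $\beta$ into the identity. Then some sequence of exactly $k+2m$ applications of $\mathrm{cdr}$ transforms $\pi$ into the identity, and every sequence of applications of $\mathrm{cdr}$ that transforms $\pi$ into the identity has length $k+2m$. (2) Hence the number of applications of $\mathrm{cdr}$ needed to sort $\pi$ can be found by indiscriminate applications of $\mathrm{cdr}$ and then of $\mathrm{cds}$: there is no infinite sequence of successive applications of $\mathrm{cdr}$ starting at $\pi$; for every fixed point $\beta$ of $\mathrm{cdr}$ that is reached from $\pi$ by applications of $\mathrm{cdr}$ there is no infinite sequence of successive applications of $\mathrm{cds}$ starting at $\beta$; and every fixed point of $\mathrm{cds}$ that is reached from such a $\beta$ by applications of $\mathrm{cds}$ is the identity. -/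

import Mathlib

namespace ContextDirected

/-- `a` is the one-line notation `[a₁, …, aₙ]` of a signed permutation of order `n`: the absolute
values of its entries are `1, …, n`, each occurring exactly once. -/
def IsSignedPerm (n : ℕ) (a : List ℤ) : Prop :=
  (a.map Int.natAbs).Perm (List.range' 1 n)

/-- The identity permutation `[1, 2, …, n]`. -/
def idPerm (n : ℕ) : List ℤ :=
  (List.range' 1 n).map (fun i : ℕ => (i : ℤ))

/-- The head pointer `(|k|, |k| + 1)` of the entry `k`. -/
def headPtr (k : ℤ) : ℕ × ℕ := (k.natAbs, k.natAbs + 1)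

/-- The tail pointer `(|k| - 1, |k|)` of the entry `k` (entries are nonzero). -/
def tailPtr (k : ℤ) : ℕ × ℕ := (k.natAbs - 1, k.natAbs)

/-- The pointer written to the left of the entry `k`: the tail if `k` is positive, the head if `k`
is negative. -/
def leftPtr (k : ℤ) : ℕ × ℕ := if 0 < k then tailPtr k else headPtr k

/-- The pointer written to the right of the entry `k`: the head if `k` is positive, the tail if `k`
is negative. -/
def rightPtr (k : ℤ) : ℕ × ℕ := if 0 < k then headPtr k else tailPtr k

/-- Reverse the order of the entries of a block and change the sign of each of them. -/
def revNeg (s : List ℤ) : List ℤ := (s.map (fun x => -x)).reverse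

/-- `CdrAt p α β`: the context directed reversal at the pointer `p` applies to `α` (its two
occurrences are in entries of opposite signs), and its result is `β`.
In a signed permutation two different entries have the same left pointer, or the same right
pointer, only if they have opposite signs. -/
inductive CdrAt (p : ℕ × ℕ) : List ℤ → List ℤ → Prop
  /-- `[…, ₚx, …, b, ₚy, …] ↦ […, -b, …, -x, y, …]`. -/
  | left (A s B : List ℤ) (x y : ℤ) (hx : leftPtr x = p) (hy : leftPtr y = p) :
      CdrAt p (A ++ (x :: s) ++ (y :: B)) (A ++ revNeg (x :: s) ++ (y :: B))
  /-- `[…, xₚ, a, …, yₚ, …] ↦ […, x, -y, …, -a, …]`. -/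
  | right (A s B : List ℤ) (x y : ℤ) (hx : rightPtr x = p) (hy : rightPtr y = p) :
      CdrAt p (A ++ [x] ++ (s ++ [y]) ++ B) (A ++ [x] ++ revNeg (s ++ [y]) ++ B)

/-- `CdsAt p q α β`: the pointers `p` and `q` occur in `α` in the order `p … q … p … q`, the
two occurrences of each of them in entries of the same sign, so that the context directed swap for
`p` and `q` applies to `α`, and its result is `β`. Each clause exchanges the blocks `S` and `T`,
the blocks between the first `p` and the first `q` and between the second `p` and the second `q`.
The variables `x`, `x'` are the entries with the pointer `p`, and `y`, `y'` those with `q`. -/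
inductive CdsAt (p q : ℕ × ℕ) : List ℤ → List ℤ → Prop
  /-- `[…, (ₚx', …, y_q), …, xₚ, (…), _qy', …]`. -/
  | case1 (A S M T C : List ℤ) (x x' y y' : ℤ)
      (hS₁ : S.head? = some x') (hS₂ : S.getLast? = some y)
      (hx : rightPtr x = p) (hx' : leftPtr x' = p) (hy : rightPtr y = q) (hy' : leftPtr y' = q) :
      CdsAt p q (A ++ S ++ (M ++ [x]) ++ T ++ (y' :: C)) (A ++ T ++ (M ++ [x]) ++ S ++ (y' :: C))
  /-- `[…, xₚ, (…, y_q), …, (ₚx', …), _qy', …]`. -/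
  | case2 (A S M T C : List ℤ) (x x' y y' : ℤ)
      (hS : S.getLast? = some y) (hT : T.head? = some x')
      (hx : rightPtr x = p) (hx' : leftPtr x' = p) (hy : rightPtr y = q) (hy' : leftPtr y' = q) :
      CdsAt p q (A ++ [x] ++ S ++ M ++ T ++ (y' :: C)) (A ++ [x] ++ T ++ M ++ S ++ (y' :: C))
  /-- `[…, xₚ, (…), _qy', …, (ₚx', …, y_q), …]`. -/
  | case3 (A S M T C : List ℤ) (x x' y y' : ℤ)
      (hT₁ : T.head? = some x') (hT₂ : T.getLast? = some y)
      (hx : rightPtr x = p) (hx' : leftPtr x' = p) (hy : rightPtr y = q) (hy' : leftPtr y' = q) :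
      CdsAt p q (A ++ [x] ++ S ++ (y' :: M) ++ T ++ C) (A ++ [x] ++ T ++ (y' :: M) ++ S ++ C)
  /-- `[…, (ₚx', …), _qy', …, xₚ, (…, y_q), …]`. -/
  | case4 (A S M T C : List ℤ) (x x' y y' : ℤ)
      (hS : S.head? = some x') (hM₁ : M.head? = some y') (hM₂ : M.getLast? = some x)
      (hT : T.getLast? = some y)
      (hx : rightPtr x = p) (hx' : leftPtr x' = p) (hy : rightPtr y = q) (hy' : leftPtr y' = q) :
      CdsAt p q (A ++ S ++ M ++ T ++ C) (A ++ T ++ M ++ S ++ C)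

/-- One application of cdr: `β = cdr_p(α)` for some pointer `p` at which cdr applies to `α`. -/
def CdrStep (α β : List ℤ) : Prop := ∃ p, CdrAt p α β

/-- One application of cds: `β = cds_{p,q}(α)` for some pointers `p, q` for which cds applies
to `α`. -/
def CdsStep (α β : List ℤ) : Prop := ∃ p q, CdsAt p q α β

/-- `Steps R k α β`: exactly `k` successive applications of `R` lead from `α` to `β`. -/
inductive Steps (R : List ℤ → List ℤ → Prop) : ℕ → List ℤ → List ℤ → Prop
  | zero (α : List ℤ) : Steps R 0 α α
  | succ {k : ℕ} {α β γ : List ℤ} (h : Steps R k α β) (hstep : R β γ) : Steps R (k + 1) α γ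

/-- No application of `R` is possible. -/
def IsFixedPoint (R : List ℤ → List ℤ → Prop) (α : List ℤ) : Prop := ∀ β, ¬ R α β

/-- From `α`, the operation `R` cannot be applied forever. -/
def Terminates (R : List ℤ → List ℤ → Prop) (α : List ℤ) : Prop :=
  ¬ ∃ f : ℕ → List ℤ, f 0 = α ∧ ∀ i, R (f i) (f (i + 1))

/-- Some finite number of applications of cdr transforms `α` into the identity permutation. -/
def CdrSortable (n : ℕ) (α : List ℤ) : Prop := ∃ k, Steps CdrStep k α (idPerm n)

end ContextDirected

/-! Join the right pointer of each entry to the left pointer of the next one, and close the list up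
with (0, 1) in front and (n, n + 1) at the back. In this graph every pointer has degree two, so the
graph is a union of cycles. A reversal at p replaces the path a, p, b by an edge a, b and splits p
off as a loop (`CdrAt.contracts`); a swap at p, q amounts to two such contractions
(`CdsAt.exists_contracts`). Hence cdr adds one component and cds adds two, whatever choices are
made. The number of reversals that sort π is therefore the difference of the component counts of the
identity and π, which is also k + 2m; a sequence of this length exists because π is sortable. Since
the count is bounded, both operations terminate.

For the last claim, attach the ends of the list to two vertices (0, 0) and (1, 1) that are not
pointers. Contractions at vertices of degree two do not change how the remaining vertices are
connected, so `Oriented` is invariant. It holds for the identity when n > 0, hence for everything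
reached from a sortable π. At a fixed point of cdr consecutive values have equal signs; all signs
negative would contradict `Oriented` by a telescoping sum, so all entries are positive
(`Oriented.pos_of_isFixedPoint`). Swaps keep them positive. At a positive fixed point of cds no two
adjacencies interlock, so it is the identity or has 1 directly after n (`pos_rotation`); the latter
puts an edge between (n, n + 1) and (0, 1), against `Oriented`. -/

namespace ContextDirected

/-! ### Components of multigraphs under contraction of a vertex of degree two -/

section Contraction

variable {P : Type*}

/-- The rational functions on the vertices that are constant along every edge of `G`. -/
def constOn (G : Multiset (Sym2 P)) : Submodule ℚ (P → ℚ) where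
  carrier := {f | ∀ e ∈ G, (e.map f).IsDiag}
  add_mem' := by
    intro f g hf hg e he
    have h1 := hf e he
    have h2 := hg e he
    induction e using Sym2.ind
    simp_all
  zero_mem' := by
    intro e _
    induction e using Sym2.ind
    simp
  smul_mem' := by
    intro c f hf e he
    have h1 := hf e he
    induction e using Sym2.ind
    simp_all

theorem mem_constOn_cons {f : P → ℚ} {a b : P} {G : Multiset (Sym2 P)} :
    f ∈ constOn (s(a, b) ::ₘ G) ↔ f a = f b ∧ f ∈ constOn G := by
  change (∀ e ∈ _, _) ↔ _ ∧ (∀ e ∈ _, _)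
  simp

@[simp] theorem mem_constOn_zero {f : P → ℚ} : f ∈ constOn (0 : Multiset (Sym2 P)) := by
  change ∀ e ∈ _, _
  simp

theorem mem_constOn_add {f : P → ℚ} {G H : Multiset (Sym2 P)} :
    f ∈ constOn (G + H) ↔ f ∈ constOn G ∧ f ∈ constOn H := by
  change (∀ e ∈ _, _) ↔ (∀ e ∈ _, _) ∧ (∀ e ∈ _, _)
  simp only [Multiset.mem_add, or_imp, forall_and]

/-- The multiset of all end points of the edges of `G`. -/
def endpoints (G : Multiset (Sym2 P)) : Multiset P := G.bind Sym2.toMultiset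

@[simp] theorem endpoints_cons (a b : P) (G : Multiset (Sym2 P)) :
    endpoints (s(a, b) ::ₘ G) = a ::ₘ b ::ₘ endpoints G := by
  rw [endpoints, Multiset.cons_bind, show s(a, b).toMultiset = a ::ₘ b ::ₘ 0 from rfl,
    Multiset.cons_add, Multiset.cons_add, zero_add, endpoints]

theorem mem_constOn_update [DecidableEq P] {f : P → ℚ} {p : P} {c : ℚ} {G : Multiset (Sym2 P)}
    (hp : p ∉ endpoints G) :
    Function.update f p c ∈ constOn G ↔ f ∈ constOn G := by
  induction G using Multiset.induction with
  | empty => simp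
  | cons e G ih =>
    induction e using Sym2.ind with
    | _ a b =>
      simp only [endpoints_cons, Multiset.mem_cons, not_or] at hp
      rw [mem_constOn_cons, mem_constOn_cons, ih hp.2.2,
        Function.update_of_ne (Ne.symm hp.1), Function.update_of_ne (Ne.symm hp.2.1)]

/-- `G'` arises from `G` by contracting the path `a, p, b` to one edge and leaving a loop
at `p`. -/
def Contracts (p : P) (G G' : Multiset (Sym2 P)) : Prop :=
  ∃ (a b : P) (H : Multiset (Sym2 P)),
    G = s(a, p) ::ₘ s(p, b) ::ₘ H ∧ G' = s(p, p) ::ₘ s(a, b) ::ₘ H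

namespace Contracts

variable {p : P} {G G' : Multiset (Sym2 P)}

theorem endpoints_eq (h : Contracts p G G') : endpoints G' = endpoints G := by
  obtain ⟨a, b, H, rfl, rfl⟩ := h
  simp only [endpoints_cons]
  rw [Multiset.cons_swap p a, Multiset.cons_swap p a]

theorem two_le_count [DecidableEq P] (h : Contracts p G G') : 2 ≤ (endpoints G).count p := by
  obtain ⟨a, b, H, rfl, rfl⟩ := h
  simp only [endpoints_cons, Multiset.count_cons, if_true]
  omega

theorem mem_endpoints (h : Contracts p G G') : p ∈ endpoints G := by
  obtain ⟨a, b, H, rfl, rfl⟩ := h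
  simp

/-- The edges at p already use up its degree, so a and b differ from p and H avoids p. Thus the
value at p is dictated by that at a in G, is free in G', and nothing else distinguishes the two
function spaces. -/
theorem exists_neighbor [DecidableEq P] (h : Contracts p G G') (hp : (endpoints G).count p ≤ 2) :
    ∃ a, a ≠ p ∧ constOn G ≤ constOn G' ∧ Pi.single p 1 ∈ constOn G' ∧
      (∀ f ∈ constOn G, f a = f p) ∧
      ∀ f ∈ constOn G', Function.update f p (f a) ∈ constOn G := by
  obtain ⟨a, b, H, rfl, rfl⟩ := h
  simp only [endpoints_cons, Multiset.count_cons, if_true] at hp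
  have ha : a ≠ p := by rintro rfl; simp only [if_true] at hp; omega
  have hb : b ≠ p := by rintro rfl; simp only [if_true] at hp; omega
  have hH : p ∉ endpoints H := by
    rw [← Multiset.count_eq_zero]
    omega
  refine ⟨a, ha, ?_, ?_, ?_, ?_⟩
  · intro f hf
    simp only [mem_constOn_cons] at hf ⊢
    exact ⟨trivial, hf.1.trans hf.2.1, hf.2.2⟩
  · simp only [mem_constOn_cons]
    refine ⟨trivial, ?_, ?_⟩
    · simp [Pi.single_eq_of_ne, ha, hb]
    · have := (mem_constOn_update (f := 0) (c := 1) hH).2 (Submodule.zero_mem _)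
      exact this
  · intro f hf
    exact (mem_constOn_cons.1 hf).1
  · intro f hf
    simp only [mem_constOn_cons] at hf ⊢
    refine ⟨?_, ?_, (mem_constOn_update hH).2 hf.2.2⟩
    · simp [Function.update_of_ne ha]
    · simp [Function.update_of_ne hb, hf.2.1]

end Contracts

/-- The functions that vanish outside `T`. -/
def supportedIn (T : Finset P) : Submodule ℚ (P → ℚ) where
  carrier := {f | ∀ x, x ∉ T → f x = 0}
  add_mem' := by
    intro f g hf hg x hx
    simp [hf x hx, hg x hx]
  zero_mem' := by
    intro x _
    rfl
  smul_mem' := by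
    intro c f hf x hx
    simp [hf x hx]

instance (T : Finset P) : FiniteDimensional ℚ (supportedIn T) := by
  refine FiniteDimensional.of_injective
    ((LinearMap.funLeft ℚ ℚ (Subtype.val : T → P)).comp (supportedIn T).subtype) ?_
  rintro ⟨f, hf⟩ ⟨g, hg⟩ h
  ext x
  by_cases hx : x ∈ T
  · exact congrFun h ⟨x, hx⟩
  · exact (hf x hx).trans (hg x hx).symm

/-- The dimension of the space of functions on `T` that are constant along the edges of `G`; it
counts the connected components of `G`. -/
noncomputable def numComponents (T : Finset P) (G : Multiset (Sym2 P)) : ℕ :=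
  Module.finrank ℚ (constOn G ⊓ supportedIn T : Submodule ℚ (P → ℚ))

theorem numComponents_le (T : Finset P) (G : Multiset (Sym2 P)) :
    numComponents T G ≤ Module.finrank ℚ (supportedIn T) :=
  Submodule.finrank_mono inf_le_right

/-- The space for G' is the direct sum of the space for G and the line spanned by the indicator of
p. -/
theorem Contracts.numComponents_eq [DecidableEq P] {p : P} {G G' : Multiset (Sym2 P)}
    {T : Finset P} (h : Contracts p G G') (hp : (endpoints G).count p ≤ 2) (hT : ∀ x ∈ endpoints G, x ∈ T) :
    numComponents T G' = numComponents T G + 1 := by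
  have hpT : p ∈ T := hT p h.mem_endpoints
  obtain ⟨a, ha, hle, hs, hc, hu⟩ := h.exists_neighbor hp
  have hsT : (Pi.single p 1 : P → ℚ) ∈ supportedIn T := by
    intro x hx
    exact Pi.single_eq_of_ne (by rintro rfl; exact hx hpT) 1
  have hsup : (constOn G' ⊓ supportedIn T : Submodule ℚ (P → ℚ)) =
      (constOn G ⊓ supportedIn T) ⊔ Submodule.span ℚ {Pi.single p 1} := by
    apply le_antisymm
    · rintro f ⟨hf, hfT⟩
      rw [Submodule.mem_sup]
      refine ⟨Function.update f p (f a), ⟨hu f hf, ?_⟩, (f p - f a) • Pi.single p 1,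
        Submodule.smul_mem _ _ (Submodule.mem_span_singleton_self _), ?_⟩
      · intro x hx
        rw [Function.update_of_ne (by rintro rfl; exact hx hpT)]
        exact hfT x hx
      · ext x
        by_cases hx : x = p
        · subst hx
          simp
        · simp [Function.update_of_ne hx, Pi.single_eq_of_ne hx]
    · refine sup_le (inf_le_inf_right _ hle) ?_
      rw [Submodule.span_singleton_le_iff_mem]
      exact ⟨hs, hsT⟩
  have hinf : (constOn G ⊓ supportedIn T) ⊓ Submodule.span ℚ {(Pi.single p 1 : P → ℚ)} = ⊥ := by
    rw [eq_bot_iff]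
    rintro f ⟨hf, hf'⟩
    obtain ⟨c, rfl⟩ := Submodule.mem_span_singleton.1 hf'
    have := hc _ hf.1
    simp only [Pi.smul_apply, Pi.single_eq_same, Pi.single_eq_of_ne ha, smul_eq_mul, mul_zero,
      mul_one] at this
    simp [← this]
  have hne : (Pi.single p 1 : P → ℚ) ≠ 0 := by
    intro h0
    simpa using congrFun h0 p
  have : FiniteDimensional ℚ (constOn G ⊓ supportedIn T : Submodule ℚ (P → ℚ)) :=
    Submodule.finiteDimensional_of_le inf_le_right
  have hd := Submodule.finrank_sup_add_finrank_inf_eq (constOn G ⊓ supportedIn T)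
    (Submodule.span ℚ {(Pi.single p 1 : P → ℚ)})
  rw [hinf, finrank_bot, finrank_span_singleton hne, ← hsup] at hd
  exact hd

/-- In `G`, the vertices `i` and `u` are connected, so are `j` and `v`, and `u` and `v` are not. -/
def Separates (i u j v : P) (G : Multiset (Sym2 P)) : Prop :=
  (∀ f ∈ constOn G, f i = f u ∧ f j = f v) ∧ ∃ f ∈ constOn G, f u ≠ f v

/-- Resetting the value at p turns a function constant along G' into one constant along G, and
values at other vertices stay. -/
theorem Contracts.separates_iff [DecidableEq P] {p i u j v : P} {G G' : Multiset (Sym2 P)}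
    (h : Contracts p G G') (hp : (endpoints G).count p ≤ 2)
    (hi : i ≠ p) (hu : u ≠ p) (hj : j ≠ p) (hv : v ≠ p) :
    Separates i u j v G' ↔ Separates i u j v G := by
  obtain ⟨a, ha, hle, -, -, hup⟩ := h.exists_neighbor hp
  constructor
  · rintro ⟨h1, f, hf, hne⟩
    refine ⟨fun g hg => h1 g (hle hg), _, hup f hf, ?_⟩
    rwa [Function.update_of_ne hu, Function.update_of_ne hv]
  · rintro ⟨h1, f, hf, hne⟩
    refine ⟨fun g hg => ?_, f, hle hf, hne⟩
    have := h1 _ (hup g hg)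
    rwa [Function.update_of_ne hu, Function.update_of_ne hv, Function.update_of_ne hi,
      Function.update_of_ne hj] at this

end Contraction

/-! ### The gap graph of a list and its decomposition into blocks -/

/-- The graph on pointers with one edge for each place between consecutive entries of `α`, where
`i` and `j` stand before and after `α`. -/
def gaps : ℕ × ℕ → List ℤ → ℕ × ℕ → Multiset (Sym2 (ℕ × ℕ))
  | i, [], j => {s(i, j)}
  | i, a :: t, j => s(i, leftPtr a) ::ₘ gaps (rightPtr a) t j

theorem endpoints_gaps (α : List ℤ) (i j : ℕ × ℕ) :
    endpoints (gaps i α j) =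
      i ::ₘ j ::ₘ ((α.map leftPtr : Multiset (ℕ × ℕ)) + (α.map rightPtr : Multiset (ℕ × ℕ))) := by
  induction α generalizing i with
  | nil => exact endpoints_cons i j 0
  | cons a t ih =>
    rw [gaps, endpoints_cons, ih]
    simp only [List.map_cons, ← Multiset.cons_coe, Multiset.cons_add, Multiset.add_cons]
    ext x
    simp only [Multiset.count_cons, Multiset.count_add]
    ring

theorem gaps_append_cons (A : List ℤ) (b : ℤ) (B : List ℤ) (i j : ℕ × ℕ) :
    gaps i (A ++ b :: B) j = gaps i A (leftPtr b) + gaps (rightPtr b) B j := by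
  induction A generalizing i with
  | nil => simp [gaps]
  | cons a t ih => simp [gaps, ih]

/-- The edges left of the end of `A`, and the pointer at this end. -/
theorem exists_gaps_append_left (i : ℕ × ℕ) (A : List ℤ) :
    ∃ a H, ∀ S k, gaps i (A ++ S) k = H + gaps a S k := by
  induction A generalizing i with
  | nil => exact ⟨i, 0, by simp⟩
  | cons x t ih =>
    obtain ⟨a, H, h⟩ := ih (rightPtr x)
    exact ⟨a, s(i, leftPtr x) ::ₘ H, fun S k => by simp [gaps, h]⟩

theorem exists_gaps_append_right (B : List ℤ) (j : ℕ × ℕ) :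
    ∃ c H, ∀ S z, gaps z (S ++ B) j = gaps z S c + H := by
  cases B with
  | nil => exact ⟨j, 0, by simp⟩
  | cons b t => exact ⟨leftPtr b, gaps (rightPtr b) t j, fun S z => gaps_append_cons S b t z j⟩

/-- The block may be empty, and then its only edge ends at `k`. Since `b` and `H` do not depend on
`z`, the near end can be reattached in either case. -/
theorem exists_gaps_eq_cons (S : List ℤ) (k : ℕ × ℕ) :
    ∃ b H, ∀ z, gaps z S k = s(z, b) ::ₘ H := by
  cases S with
  | nil => exact ⟨k, 0, fun z => rfl⟩
  | cons a t => exact ⟨leftPtr a, gaps (rightPtr a) t k, fun z => rfl⟩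

theorem exists_gaps_eq_cons_last (i : ℕ × ℕ) (S : List ℤ) :
    ∃ b H, ∀ z, gaps i S z = s(b, z) ::ₘ H := by
  obtain ⟨a, H, h⟩ := exists_gaps_append_left i S
  refine ⟨a, H, fun z => ?_⟩
  have := h [] z
  rw [List.append_nil] at this
  rw [this, gaps, add_comm, Multiset.singleton_add]

/-- The edges of a nonempty block whose first entry is `x` and whose last entry is `y`. -/
theorem exists_gaps_block {S : List ℤ} {x y : ℤ} (hx : S.head? = some x)
    (hy : S.getLast? = some y) :
    ∃ H, ∀ i Z k, gaps i (S ++ Z) k = s(i, leftPtr x) ::ₘ (H + gaps (rightPtr y) Z k) := by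
  induction S generalizing x with
  | nil => simp at hx
  | cons a t ih =>
    obtain rfl : a = x := by simpa using hx
    cases t with
    | nil =>
      obtain rfl : a = y := by simpa using hy
      exact ⟨0, fun i Z k => by simp [gaps]⟩
    | cons b t =>
      rw [List.getLast?_cons_cons] at hy
      obtain ⟨H, h⟩ := ih (x := b) rfl hy
      refine ⟨s(rightPtr a, leftPtr b) ::ₘ H, fun i Z k => ?_⟩
      rw [List.cons_append, gaps, h, Multiset.cons_add]

theorem exists_gaps_getLast {S : List ℤ} {y : ℤ} (hy : S.getLast? = some y) :
    ∃ b H, ∀ i Z k, gaps i (S ++ Z) k = s(i, b) ::ₘ (H + gaps (rightPtr y) Z k) := by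
  cases S with
  | nil => simp at hy
  | cons a t =>
    obtain ⟨H, h⟩ := exists_gaps_block (x := a) rfl hy
    exact ⟨_, H, h⟩

/-! ### Reversals and swaps as contractions -/

theorem leftPtr_neg {x : ℤ} (hx : x ≠ 0) : leftPtr (-x) = rightPtr x := by
  unfold leftPtr rightPtr headPtr tailPtr
  rcases lt_or_gt_of_ne hx with h | h
  · simp [h, h.le]
  · simp [h, h.le]

theorem rightPtr_neg {x : ℤ} (hx : x ≠ 0) : rightPtr (-x) = leftPtr x := by
  rw [← leftPtr_neg (neg_ne_zero.2 hx), neg_neg]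

theorem revNeg_cons (x : ℤ) (s : List ℤ) : revNeg (x :: s) = revNeg s ++ [-x] := by
  simp [revNeg]

/-- A sign change exchanges the two pointers of an entry, so the new block is the old one read
backwards and has the same edges. -/
theorem gaps_revNeg (s : List ℤ) (hs : ∀ x ∈ s, x ≠ 0) (i j : ℕ × ℕ) :
    gaps i (revNeg s) j = gaps j s i := by
  induction s generalizing j with
  | nil => simp [revNeg, gaps, Sym2.eq_swap]
  | cons x t ih =>
    rw [revNeg_cons, gaps_append_cons, ih (fun y hy => hs y (List.mem_cons_of_mem _ hy)),
      leftPtr_neg (hs x List.mem_cons_self), rightPtr_neg (hs x List.mem_cons_self)]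
    simp only [gaps]
    rw [add_comm, Multiset.singleton_add, Sym2.eq_swap]

/-- Reversal changes only the gaps at the two ends of the block, where the edges a, p and p, b sit.
Afterwards the two occurrences of p face each other across one gap, which gives the loop, and a
faces b across the other. -/
theorem CdrAt.contracts {p : ℕ × ℕ} {α β : List ℤ} (h : CdrAt p α β) (h0 : ∀ x ∈ α, x ≠ 0)
    (i j : ℕ × ℕ) : Contracts p (gaps i α j) (gaps i β j) := by
  cases h with
  | left A s B x y hx hy =>
    obtain ⟨a, HA, hA⟩ := exists_gaps_append_left i A
    obtain ⟨b, Hs, hs⟩ := exists_gaps_eq_cons_last (rightPtr x) s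
    refine ⟨a, b, HA + (Hs + gaps (rightPtr y) B j), ?_, ?_⟩
    · rw [List.append_assoc, hA, List.cons_append, gaps, gaps_append_cons, hs, hx, hy,
        Sym2.eq_swap (a := p) (b := b)]
      simp only [← Multiset.singleton_add]
      abel
    · rw [revNeg_cons, List.append_assoc, hA, gaps_append_cons, gaps_append_cons, gaps_revNeg, gaps,
        leftPtr_neg (h0 x (by simp)), rightPtr_neg (h0 x (by simp)), hs, hx, hy,
        Sym2.eq_swap (a := a) (b := b)]
      · simp only [← Multiset.singleton_add]
        abel
      · intro z hz
        exact h0 z (by simp [hz])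
  | right A s B x y hx hy =>
    obtain ⟨HA, hA⟩ : ∃ H, ∀ Z, gaps i (A ++ [x] ++ Z) j = H + gaps p Z j := by
      obtain ⟨b, H, h⟩ := exists_gaps_getLast (S := A ++ [x]) (y := x) (by simp)
      exact ⟨s(i, b) ::ₘ H, fun Z => by rw [h, hx, Multiset.cons_add]⟩
    obtain ⟨c, HB, hB⟩ := exists_gaps_append_right B j
    obtain ⟨b, Hs, hs⟩ := exists_gaps_eq_cons s (leftPtr y)
    refine ⟨b, c, HA + (Hs + HB), ?_, ?_⟩
    · rw [List.append_assoc, hA, hB, gaps_append_cons, hs, hy, gaps,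
        Sym2.eq_swap (a := p) (b := b)]
      simp only [← Multiset.singleton_add]
      abel
    · rw [List.append_assoc, hA, hB, gaps_revNeg, gaps_append_cons, hs, hy, gaps,
        Sym2.eq_swap (a := c) (b := b)]
      · simp only [← Multiset.singleton_add]
        abel
      · intro z hz
        exact h0 z (by simpa using Or.inr (Or.inr (by simpa [or_assoc] using Or.inl hz)))

/-- Contractions at `p` and then at `q`, where `E` are the edges of a possibly empty block whose
ends are attached to `p` and `q`. -/
theorem exists_contracts_contracts {P : Type*} {p q a c : P} {G G' R : Multiset (Sym2 P)}
    (E : P → P → Multiset (Sym2 P))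
    (hl : ∀ w, ∃ b H, ∀ z, E z w = s(z, b) ::ₘ H) (hr : ∀ z, ∃ b H, ∀ w, E z w = s(b, w) ::ₘ H)
    (hG : G = s(a, p) ::ₘ s(q, c) ::ₘ (E p q + R))
    (hG' : G' = s(p, p) ::ₘ s(q, q) ::ₘ (E a c + R)) :
    ∃ G'', Contracts p G G'' ∧ Contracts q G'' G' := by
  obtain ⟨b, H, h⟩ := hl q
  obtain ⟨d, K, k⟩ := hr a
  refine ⟨s(p, p) ::ₘ s(q, c) ::ₘ (E a q + R), ⟨a, b, s(q, c) ::ₘ (H + R), ?_, ?_⟩,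
    ⟨d, c, s(p, p) ::ₘ (K + R), ?_, ?_⟩⟩
  · rw [hG, h]
    simp only [← Multiset.singleton_add]
    abel
  · rw [h]
    simp only [← Multiset.singleton_add]
    abel
  · rw [k]
    simp only [← Multiset.singleton_add]
    abel
  · rw [hG', k]
    simp only [← Multiset.singleton_add]
    abel

theorem exists_gaps_append_block {S : List ℤ} {x y : ℤ} (hx : S.head? = some x)
    (hy : S.getLast? = some y) :
    ∃ H, (∀ i Z k, gaps i (S ++ Z) k = s(i, leftPtr x) ::ₘ (H + gaps (rightPtr y) Z k)) ∧
      ∀ i T Z k, gaps i (T ++ (S ++ Z)) k =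
        gaps i T (leftPtr x) + (H + gaps (rightPtr y) Z k) := by
  obtain ⟨H, h⟩ := exists_gaps_block hx hy
  refine ⟨H, h, fun i T Z k => ?_⟩
  cases S with
  | nil => simp at hx
  | cons a S =>
    obtain rfl : a = x := by simpa using hx
    have := h (0, 0) Z k
    rw [List.cons_append, gaps] at this
    rw [List.cons_append, gaps_append_cons, (Multiset.cons_inj_right _).1 this]

/-- The swap brings the two occurrences of p together, and likewise those of q. The intermediate
graph `G` need not come from a signed permutation, so only its existence is asserted. In the first
three cases the part between p and q played by E in `exists_contracts_contracts` is the block that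
may be empty. -/
theorem CdsAt.exists_contracts {p q : ℕ × ℕ} {α β : List ℤ} (h : CdsAt p q α β) (i j : ℕ × ℕ) :
    ∃ r s G, Contracts r (gaps i α j) G ∧ Contracts s G (gaps i β j) := by
  have head (N : List ℤ) (x : ℤ) (hN : N.getLast? = some x) : ∃ m, N.head? = some m := by
    cases N <;> simp at hN ⊢
  have last (N : List ℤ) (x : ℤ) (hN : N.head? = some x) : ∃ m, N.getLast? = some m := by
    cases N with
    | nil => simp at hN
    | cons a t => exact ⟨_, List.getLast?_eq_some_getLast (List.cons_ne_nil a t)⟩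
  cases h with
  | case1 A S M T C x x' y y' hS₁ hS₂ hx hx' hy hy' =>
    obtain ⟨a, HA, hA⟩ := exists_gaps_append_left i A
    obtain ⟨HS, hS, -⟩ := exists_gaps_append_block hS₁ hS₂
    have hN : (M ++ [x]).getLast? = some x := by simp
    generalize M ++ [x] = N at hN
    obtain ⟨m, hm⟩ := head N x hN
    obtain ⟨HN, hN, hN'⟩ := exists_gaps_append_block hm hN
    refine ⟨p, q, exists_contracts_contracts (a := a) (c := leftPtr m) (R := HA + (HS + (HN +
      gaps (rightPtr y') C j))) (fun z w => gaps z T w) (exists_gaps_eq_cons T)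
      (fun z => exists_gaps_eq_cons_last z T) ?_ ?_⟩
    · simp only [List.append_assoc]
      rw [hA, hS, hN, gaps_append_cons, hx, hx', hy, hy']
      simp only [← Multiset.singleton_add]
      abel
    · simp only [List.append_assoc]
      rw [hA, hN', hS, gaps, hx, hx', hy, hy']
      simp only [← Multiset.singleton_add]
      abel
  | case2 A S M T C x x' y y' hS hT hx hx' hy hy' =>
    have hN : (A ++ [x]).getLast? = some x := by simp
    generalize A ++ [x] = N at hN
    obtain ⟨n, hn⟩ := head N x hN
    obtain ⟨HN, hN, -⟩ := exists_gaps_append_block hn hN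
    obtain ⟨s, hs⟩ := head S y hS
    obtain ⟨t, ht⟩ := last T x' hT
    obtain ⟨HS, hS, hS'⟩ := exists_gaps_append_block hs hS
    obtain ⟨HT, hT, hT'⟩ := exists_gaps_append_block hT ht
    -- The possibly empty block M runs from q to p here, so q is contracted first.
    obtain ⟨G, h₁, h₂⟩ := exists_contracts_contracts (p := q) (q := p) (a := rightPtr t)
      (c := leftPtr s) (R := s(i, leftPtr n) ::ₘ (HN + (HS + (HT + gaps (rightPtr y') C j))))
      (G := gaps i (N ++ S ++ M ++ T ++ y' :: C) j) (G' := gaps i (N ++ T ++ M ++ S ++ y' :: C) j)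
      (fun z w => gaps z M w) (exists_gaps_eq_cons M)
      (fun z => exists_gaps_eq_cons_last z M) (by
        simp only [List.append_assoc]
        rw [hN, hS, hT', gaps, hx, hx', hy, hy']
        simp only [← Multiset.singleton_add]
        abel) (by
        simp only [List.append_assoc]
        rw [hN, hT, hS', gaps, hx, hx', hy, hy']
        simp only [← Multiset.singleton_add]
        abel)
    exact ⟨_, _, G, h₁, h₂⟩
  | case3 A S M T C x x' y y' hT₁ hT₂ hx hx' hy hy' =>
    have hN : (A ++ [x]).getLast? = some x := by simp
    generalize A ++ [x] = N at hN
    obtain ⟨n, hn⟩ := head N x hN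
    obtain ⟨HN, hN, -⟩ := exists_gaps_append_block hn hN
    obtain ⟨HT, hT, hT'⟩ := exists_gaps_append_block hT₁ hT₂
    have hK : (y' :: M).head? = some y' := rfl
    generalize y' :: M = K at hK
    obtain ⟨k, hk⟩ := last K y' hK
    obtain ⟨HK, hK, hK'⟩ := exists_gaps_append_block hK hk
    obtain ⟨c, HC, hC⟩ := exists_gaps_append_right C j
    have hC' := hC []
    simp only [List.nil_append, gaps] at hC'
    obtain ⟨G, h₁, h₂⟩ := exists_contracts_contracts (p := p) (q := q) (a := rightPtr k)
      (c := c) (R := s(i, leftPtr n) ::ₘ (HN + (HK + (HT + HC))))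
      (G := gaps i (N ++ S ++ K ++ T ++ C) j) (G' := gaps i (N ++ T ++ K ++ S ++ C) j)
      (fun z w => gaps z S w) (exists_gaps_eq_cons S)
      (fun z => exists_gaps_eq_cons_last z S) (by
        simp only [List.append_assoc]
        rw [hN, hK', hT, hC', hx, hx', hy, hy']
        simp only [← Multiset.singleton_add]
        abel) (by
        simp only [List.append_assoc]
        rw [hN, hT, hK, hC, hx, hx', hy, hy']
        simp only [← Multiset.singleton_add]
        abel)
    exact ⟨_, _, G, h₁, h₂⟩
  | case4 A S M T C x x' y y' hS hM₁ hM₂ hT hx hx' hy hy' =>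
    obtain ⟨a, HA, hA⟩ := exists_gaps_append_left i A
    obtain ⟨s, hs⟩ := last S x' hS
    obtain ⟨t, ht⟩ := head T y hT
    obtain ⟨HS, hS, -⟩ := exists_gaps_append_block hS hs
    obtain ⟨HM, hM, -⟩ := exists_gaps_append_block hM₁ hM₂
    obtain ⟨HT, hT, -⟩ := exists_gaps_append_block ht hT
    obtain ⟨c, HC, hC⟩ := exists_gaps_eq_cons C j
    -- The blocks S, M, T are nonempty, so p and q are not ends of a common block that may be empty;
    -- E consists of the two gap edges at the start of T and at the end of S.
    refine ⟨p, q, exists_contracts_contracts (p := p) (q := q) (a := a)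
      (c := c) (R := HA + (HS + (HM + (HT + HC))))
      (fun z w => s(z, leftPtr t) ::ₘ {s(rightPtr s, w)}) (fun w => ⟨_, _, fun z => rfl⟩)
      (fun z => ⟨rightPtr s, {s(z, leftPtr t)}, fun w => Multiset.cons_swap _ _ _⟩) ?_ ?_⟩
    · simp only [List.append_assoc]
      rw [hA, hS, hM, hT, hC, hx, hx', hy, hy']
      simp only [← Multiset.singleton_add]
      abel
    · simp only [List.append_assoc]
      rw [hA, hT, hM, hS, hC, hx, hx', hy, hy']
      simp only [← Multiset.singleton_add]
      abel

/-! ### Signed permutations and the degrees in their gap graphs -/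

theorem perm_map_natAbs_revNeg (s : List ℤ) :
    (s.map Int.natAbs).Perm ((revNeg s).map Int.natAbs) := by
  have : (revNeg s).map Int.natAbs = (s.map Int.natAbs).reverse := by
    simp [revNeg, Function.comp_def]
  rw [this]
  exact (List.reverse_perm _).symm

theorem CdrAt.perm {p : ℕ × ℕ} {α β : List ℤ} (h : CdrAt p α β) :
    (α.map Int.natAbs).Perm (β.map Int.natAbs) := by
  have key (A s B : List ℤ) :
      ((A ++ s ++ B).map Int.natAbs).Perm ((A ++ revNeg s ++ B).map Int.natAbs) := by
    simp only [List.map_append]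
    exact ((perm_map_natAbs_revNeg s).append_left _).append_right _
  cases h <;> exact key _ _ _

theorem CdsAt.perm {p q : ℕ × ℕ} {α β : List ℤ} (h : CdsAt p q α β) : α.Perm β := by
  have key (A S M T C : List ℤ) : (A ++ S ++ M ++ T ++ C).Perm (A ++ T ++ M ++ S ++ C) := by
    simp only [← Multiset.coe_eq_coe, ← Multiset.coe_add]
    abel
  cases h <;> exact key _ _ _ _ _

namespace IsSignedPerm

variable {n : ℕ} {α β : List ℤ}

theorem ne_zero (h : IsSignedPerm n α) {x : ℤ} (hx : x ∈ α) : x ≠ 0 := by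
  rintro rfl
  have := h.subset (List.mem_map_of_mem hx)
  simp at this

theorem of_cdrStep (h : IsSignedPerm n α) (hs : CdrStep α β) : IsSignedPerm n β := by
  obtain ⟨p, hp⟩ := hs
  exact hp.perm.symm.trans h

theorem of_cdsStep (h : IsSignedPerm n α) (hs : CdsStep α β) : IsSignedPerm n β := by
  obtain ⟨p, q, hp⟩ := hs
  exact (hp.perm.map _).symm.trans h

/-- Every entry has one head and one tail. -/
theorem map_leftPtr_add_map_rightPtr (h : IsSignedPerm n α) :
    (α.map leftPtr : Multiset (ℕ × ℕ)) + (α.map rightPtr : Multiset (ℕ × ℕ)) =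
      ((List.range' 1 n).map (fun k => (k - 1, k)) : Multiset (ℕ × ℕ)) +
        ((List.range' 1 n).map (fun k => (k, k + 1)) : Multiset (ℕ × ℕ)) := by
  have hsplit : (α.map leftPtr : Multiset (ℕ × ℕ)) + (α.map rightPtr : Multiset (ℕ × ℕ)) =
      ((α.map Int.natAbs).map (fun k => (k - 1, k)) : Multiset (ℕ × ℕ)) +
        ((α.map Int.natAbs).map (fun k => (k, k + 1)) : Multiset (ℕ × ℕ)) := by
    clear h
    induction α with
    | nil => rfl
    | cons a t ih =>
      simp only [List.map_cons, ← Multiset.cons_coe, Multiset.cons_add, Multiset.add_cons, ih]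
      by_cases ha : 0 < a
      · simp only [leftPtr, rightPtr, ha, if_true, tailPtr, headPtr]
      · simp only [leftPtr, rightPtr, ha, if_false, tailPtr, headPtr]
        rw [Multiset.cons_swap]
  rw [hsplit, Multiset.coe_eq_coe.2 (h.map _), Multiset.coe_eq_coe.2 (h.map _)]

end IsSignedPerm

theorem count_tails (n : ℕ) (p : ℕ × ℕ) :
    ((List.range' 1 n).map (fun k => (k - 1, k)) : Multiset (ℕ × ℕ)).count p =
      if 1 ≤ p.2 ∧ p.2 ≤ n ∧ p.1 + 1 = p.2 then 1 else 0 := by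
  have hnd : ((List.range' 1 n).map (fun k => (k - 1, k))).Nodup :=
    List.Nodup.map (fun a b h => (Prod.ext_iff.1 h).2) List.nodup_range'
  rw [Multiset.count_eq_of_nodup (Multiset.coe_nodup.2 hnd)]
  obtain ⟨a, b⟩ := p
  refine if_congr ?_ rfl rfl
  simp only [Multiset.mem_coe, List.mem_map, List.mem_range'_1, Prod.mk.injEq]
  constructor
  · rintro ⟨k, hk, rfl, rfl⟩
    omega
  · rintro h
    exact ⟨b, by omega, by omega, rfl⟩

theorem count_heads (n : ℕ) (p : ℕ × ℕ) :
    ((List.range' 1 n).map (fun k => (k, k + 1)) : Multiset (ℕ × ℕ)).count p =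
      if 1 ≤ p.1 ∧ p.1 ≤ n ∧ p.1 + 1 = p.2 then 1 else 0 := by
  have hnd : ((List.range' 1 n).map (fun k => (k, k + 1))).Nodup :=
    List.Nodup.map (fun a b h => (Prod.ext_iff.1 h).1) List.nodup_range'
  rw [Multiset.count_eq_of_nodup (Multiset.coe_nodup.2 hnd)]
  obtain ⟨a, b⟩ := p
  refine if_congr ?_ rfl rfl
  simp only [Multiset.mem_coe, List.mem_map, List.mem_range'_1, Prod.mk.injEq]
  constructor
  · rintro ⟨k, hk, rfl, rfl⟩
    omega
  · rintro h
    exact ⟨a, by omega, rfl, h.2.2⟩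

/-- The gaps of `α` between the pointers `(0, 1)` and `(n, n + 1)`. -/
def closedGaps (n : ℕ) (α : List ℤ) : Multiset (Sym2 (ℕ × ℕ)) := gaps (0, 1) α (n, n + 1)

/-- The gaps of `α` between two vertices that are not pointers. -/
def openGaps (α : List ℤ) : Multiset (Sym2 (ℕ × ℕ)) := gaps (0, 0) α (1, 1)

/-- The pointers of the signed permutations of order `n`. -/
def pointers (n : ℕ) : Finset (ℕ × ℕ) := (Finset.range (n + 1)).image (fun k => (k, k + 1))

/-- In the graph of `α`, the front end is connected to the pointer `(0, 1)`, the back end to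
`(n, n + 1)`, and these two are not connected to each other. -/
def Oriented (n : ℕ) (α : List ℤ) : Prop :=
  Separates (0, 0) (0, 1) (1, 1) (n, n + 1) (openGaps α)

namespace IsSignedPerm

variable {n : ℕ} {α β : List ℤ}

theorem count_endpoints_closedGaps_le (h : IsSignedPerm n α) (p : ℕ × ℕ) :
    (endpoints (closedGaps n α)).count p ≤ 2 := by
  rw [closedGaps, endpoints_gaps, h.map_leftPtr_add_map_rightPtr]
  simp only [Multiset.count_cons, Multiset.count_add, count_tails,
    count_heads, Prod.ext_iff]
  split_ifs <;> omega

theorem mem_pointers (h : IsSignedPerm n α) {p : ℕ × ℕ} (hp : p ∈ endpoints (closedGaps n α)) :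
    p ∈ pointers n := by
  rw [closedGaps, endpoints_gaps, h.map_leftPtr_add_map_rightPtr, ← Multiset.count_pos] at hp
  simp only [Multiset.count_cons, Multiset.count_add, count_tails,
    count_heads, Prod.ext_iff] at hp
  simp only [pointers, Finset.mem_image, Finset.mem_range]
  refine ⟨p.1, ?_, ?_⟩
  · split_ifs at hp <;> omega
  · ext
    · rfl
    · split_ifs at hp <;> dsimp only <;> omega

/-- Contraction needs a vertex of degree two, so it never touches the four vertices in `Oriented`:
(0, 0) and (1, 1) occur only as ends, (0, 1) at most as the tail of 1, and (n, n + 1) at most as the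
head of n. -/
theorem count_endpoints_openGaps (h : IsSignedPerm n α) (p : ℕ × ℕ) :
    (endpoints (openGaps α)).count p ≤ 2 ∧
      (2 ≤ (endpoints (openGaps α)).count p →
        (0, 0) ≠ p ∧ (0, 1) ≠ p ∧ (1, 1) ≠ p ∧ (n, n + 1) ≠ p) := by
  rw [openGaps, endpoints_gaps, h.map_leftPtr_add_map_rightPtr]
  simp only [Multiset.count_cons, Multiset.count_add, count_tails,
    count_heads, Prod.ext_iff, ne_eq]
  constructor
  · split_ifs <;> omega
  · intro hp
    split_ifs at hp <;> omega

/-! ### Effect of one step on the component count and the orientation -/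

theorem numComponents_of_cdrStep (h : IsSignedPerm n α) (hs : CdrStep α β) :
    numComponents (pointers n) (closedGaps n β) =
      numComponents (pointers n) (closedGaps n α) + 1 := by
  obtain ⟨p, hp⟩ := hs
  exact (hp.contracts (fun _ => h.ne_zero) _ _).numComponents_eq
    (h.count_endpoints_closedGaps_le p) (fun _ => h.mem_pointers)

theorem numComponents_of_cdsStep (h : IsSignedPerm n α) (hs : CdsStep α β) :
    numComponents (pointers n) (closedGaps n β) =
      numComponents (pointers n) (closedGaps n α) + 2 := by
  obtain ⟨p, q, hp⟩ := hs
  obtain ⟨r, s, G, h₁, h₂⟩ := hp.exists_contracts (0, 1) (n, n + 1)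
  -- The loop left at the contracted vertex preserves all degrees, so the degree bound carries over
  -- to the intermediate graph.
  have e := h₁.endpoints_eq
  have := h₁.numComponents_eq (h.count_endpoints_closedGaps_le r) (fun _ => h.mem_pointers)
  have := h₂.numComponents_eq (T := pointers n) (e ▸ h.count_endpoints_closedGaps_le s)
    (e ▸ fun _ => h.mem_pointers)
  simp only [closedGaps] at *
  omega

theorem oriented_iff_of_cdrStep (h : IsSignedPerm n α) (hs : CdrStep α β) :
    Oriented n β ↔ Oriented n α := by
  obtain ⟨p, hp⟩ := hs
  have hc := hp.contracts (fun _ => h.ne_zero) (0, 0) (1, 1)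
  obtain ⟨h1, h2⟩ := h.count_endpoints_openGaps p
  obtain ⟨ha, hb, hc', hd⟩ := h2 hc.two_le_count
  exact hc.separates_iff h1 ha hb hc' hd

theorem oriented_iff_of_cdsStep (h : IsSignedPerm n α) (hs : CdsStep α β) :
    Oriented n β ↔ Oriented n α := by
  obtain ⟨p, q, hp⟩ := hs
  obtain ⟨r, s, G, h₁, h₂⟩ := hp.exists_contracts (0, 0) (1, 1)
  have e := h₁.endpoints_eq
  obtain ⟨hr1, hr2⟩ := h.count_endpoints_openGaps r
  obtain ⟨hs1, hs2⟩ := h.count_endpoints_openGaps s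
  obtain ⟨ha, hb, hc, hd⟩ := hr2 h₁.two_le_count
  obtain ⟨ha', hb', hc', hd'⟩ := hs2 (e ▸ h₂.two_le_count)
  exact (h₂.separates_iff (e ▸ hs1) ha' hb' hc' hd').trans (h₁.separates_iff hr1 ha hb hc hd)

end IsSignedPerm

/-! ### Orientation of the identity -/

theorem leftPtr_natCast_succ (k : ℕ) : leftPtr ((k + 1 : ℕ) : ℤ) = (k, k + 1) := by
  rw [leftPtr, if_pos (by positivity), tailPtr, Int.natAbs_natCast, Nat.add_sub_cancel]

theorem rightPtr_natCast_succ (k : ℕ) : rightPtr ((k + 1 : ℕ) : ℤ) = (k + 1, k + 2) := by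
  rw [rightPtr, if_pos (by positivity), headPtr, Int.natAbs_natCast]

/-- At the inner gaps of a block `m + 1, …, m + k` each pointer meets itself. -/
theorem mem_constOn_gaps_range' (f : ℕ × ℕ → ℚ) (i j : ℕ × ℕ) (m k : ℕ)
    (hi : f i = f (m, m + 1)) (hj : f (m + k, m + k + 1) = f j) :
    f ∈ constOn (gaps i ((List.range' (m + 1) k).map (fun l : ℕ => (l : ℤ))) j) := by
  induction k generalizing i m with
  | zero =>
    simp only [List.range'_zero, List.map_nil, gaps, ← Multiset.cons_zero, mem_constOn_cons]
    exact ⟨hi.trans hj, mem_constOn_zero⟩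
  | succ k ih =>
    rw [List.range'_succ, List.map_cons, gaps, mem_constOn_cons, leftPtr_natCast_succ,
      rightPtr_natCast_succ]
    refine ⟨hi, ih _ _ rfl ?_⟩
    rw [← hj]
    congr 2 <;> omega

theorem oriented_idPerm {n : ℕ} (hn : 0 < n) : Oriented n (idPerm n) := by
  -- The front component consists of the single edge from (0, 0) to (0, 1); its indicator separates
  -- it from (n, n + 1) because n > 0.
  refine ⟨fun f hf => ?_, fun p => if p = (0, 0) ∨ p = (0, 1) then 1 else 0, ?_, ?_⟩
  · obtain ⟨k, rfl⟩ : ∃ k, n = k + 1 := ⟨n - 1, by omega⟩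
    constructor
    · rw [openGaps, idPerm, List.range'_succ, List.map_cons, gaps, mem_constOn_cons] at hf
      exact hf.1
    · rw [openGaps, idPerm, List.range'_1_concat, List.map_append, List.map_singleton,
        gaps_append_cons, mem_constOn_add, gaps, ← Multiset.cons_zero, mem_constOn_cons,
        add_comm 1 k, rightPtr_natCast_succ] at hf
      exact hf.2.1.symm
  · apply mem_constOn_gaps_range' _ _ _ 0 n <;> simp [hn.ne']
  · simp [hn.ne']

/-! ### Fixed points of cdr -/

/-- Each gap equates the value on its left with that on its right; this is the sum of these
equations over all gaps. -/
theorem sum_of_mem_constOn_gaps {f : ℕ × ℕ → ℚ} {i j : ℕ × ℕ} {α : List ℤ}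
    (h : f ∈ constOn (gaps i α j)) :
    f i + (α.map (fun a => f (rightPtr a))).sum = (α.map (fun a => f (leftPtr a))).sum + f j := by
  induction α generalizing i with
  | nil =>
    rw [gaps, ← Multiset.cons_zero, mem_constOn_cons] at h
    simp [h.1]
  | cons a t ih =>
    rw [gaps, mem_constOn_cons] at h
    have := ih h.2
    simp only [List.map_cons, List.sum_cons]
    linarith [h.1]

theorem sum_heads_eq (f : ℕ × ℕ → ℚ) (n : ℕ) :
    f (0, 1) + ((List.range' 1 n).map (fun k => f (k, k + 1))).sum =
      ((List.range' 1 n).map (fun k => f (k - 1, k))).sum + f (n, n + 1) := by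
  induction n with
  | zero => simp
  | succ n ih =>
    rw [List.range'_1_concat]
    simp only [List.map_append, List.sum_append, List.map_singleton, List.sum_singleton]
    rw [← add_assoc, ih, add_comm 1 n, Nat.add_sub_cancel]

/-- In an oriented signed permutation some entry is positive. -/
theorem Oriented.exists_pos {n : ℕ} {α : List ℤ} (hα : IsSignedPerm n α) (h : Oriented n α) :
    ∃ x ∈ α, 0 < x := by
  by_contra! hneg
  obtain ⟨h1, f, hf, hne⟩ := h
  obtain ⟨hi, hj⟩ := h1 f hf
  have hs := sum_of_mem_constOn_gaps hf
  have e1 : α.map (fun a => f (rightPtr a)) =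
      (α.map Int.natAbs).map (fun k => f (k - 1, k)) := by
    rw [List.map_map]
    refine List.map_congr_left fun a ha => ?_
    simp [rightPtr, tailPtr, (hneg a ha).not_gt]
  have e2 : α.map (fun a => f (leftPtr a)) =
      (α.map Int.natAbs).map (fun k => f (k, k + 1)) := by
    rw [List.map_map]
    refine List.map_congr_left fun a ha => ?_
    simp [leftPtr, headPtr, (hneg a ha).not_gt]
  rw [e1, e2, (hα.map _).sum_eq, (hα.map _).sum_eq, hi, hj] at hs
  -- With only negative entries the heads stand on the left and the tails on the right. Adding this
  -- identity to `hs` cancels both sums and leaves 2 f (0, 1) = 2 f (n, n + 1).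
  have := sum_heads_eq f n
  exact hne (by linarith)

/-- Two entries with consecutive absolute values and opposite signs permit a reversal. -/
theorem exists_cdrStep_of_mem {α : List ℤ} {x y : ℤ} (hx : x ∈ α) (hy : y ∈ α) (hne : x ≠ y)
    (h : leftPtr x = leftPtr y ∨ rightPtr x = rightPtr y) : ∃ β, CdrStep α β := by
  obtain ⟨A, B, rfl⟩ := List.append_of_mem hx
  have key (A B C : List ℤ) (u v : ℤ) (h : leftPtr u = leftPtr v ∨ rightPtr u = rightPtr v) :
      ∃ β, CdrStep (A ++ u :: (B ++ v :: C)) β := by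
    rcases h with h | h
    · have := CdrAt.left A B C u v h rfl
      rw [List.append_assoc, List.cons_append] at this
      exact ⟨_, _, this⟩
    · have := CdrAt.right A B C u v h rfl
      simp only [List.append_assoc, List.cons_append, List.nil_append] at this
      exact ⟨_, _, this⟩
  rw [List.mem_append, List.mem_cons] at hy
  rcases hy with hy | rfl | hy
  · obtain ⟨A, A', rfl⟩ := List.append_of_mem hy
    rw [List.append_assoc, List.cons_append]
    exact key _ _ _ _ _ (h.imp Eq.symm Eq.symm)
  · exact absurd rfl hne
  · obtain ⟨B, B', rfl⟩ := List.append_of_mem hy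
    exact key _ _ _ _ _ h

/-- The entries of an oriented fixed point of cdr are positive. -/
theorem Oriented.pos_of_isFixedPoint {n : ℕ} {α : List ℤ} (hα : IsSignedPerm n α)
    (h : Oriented n α) (hfix : IsFixedPoint CdrStep α) : ∀ x ∈ α, 0 < x := by
  have hmem (k : ℕ) (hk : 1 ≤ k) (hkn : k ≤ n) : (k : ℤ) ∈ α ∨ -(k : ℤ) ∈ α := by
    have : k ∈ α.map Int.natAbs := hα.mem_iff.2 (by simp [List.mem_range'_1]; omega)
    obtain ⟨x, hx, hxk⟩ := List.mem_map.1 this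
    rcases Int.natAbs_eq x with hx' | hx'
    · exact Or.inl (by rwa [← hxk, ← hx'])
    · exact Or.inr (by rwa [← hxk, ← hx'])
  have hstep (k : ℕ) (hk : 1 ≤ k) : ¬ ((k : ℤ) ∈ α ∧ -((k + 1 : ℕ) : ℤ) ∈ α) ∧
      ¬ (-(k : ℤ) ∈ α ∧ ((k + 1 : ℕ) : ℤ) ∈ α) := by
    obtain ⟨l, rfl⟩ : ∃ l, k = l + 1 := ⟨k - 1, by omega⟩
    constructor
    · rintro ⟨h1, h2⟩
      obtain ⟨β, hβ⟩ := exists_cdrStep_of_mem h1 h2 (by omega) (Or.inr (by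
        rw [rightPtr_neg (by omega), rightPtr_natCast_succ, leftPtr_natCast_succ]))
      exact hfix β hβ
    · rintro ⟨h1, h2⟩
      obtain ⟨β, hβ⟩ := exists_cdrStep_of_mem h1 h2 (by omega) (Or.inl (by
        rw [leftPtr_neg (by omega), rightPtr_natCast_succ, leftPtr_natCast_succ]))
      exact hfix β hβ
  have hle {x : ℤ} (hx : x ∈ α) : 1 ≤ x.natAbs ∧ x.natAbs ≤ n := by
    have := hα.subset (List.mem_map_of_mem hx)
    rw [List.mem_range'_1] at this
    omega
  have hnd : ∀ k : ℕ, 1 ≤ k → ¬ ((k : ℤ) ∈ α ∧ -(k : ℤ) ∈ α) := by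
    rintro k hk ⟨h1, h2⟩
    have hn : (α.map Int.natAbs).Nodup := hα.nodup_iff.2 List.nodup_range'
    have := List.inj_on_of_nodup_map hn h1 h2 (by simp)
    omega
  obtain ⟨x, hx, hpos⟩ := h.exists_pos hα
  obtain ⟨m, rfl⟩ := Int.eq_ofNat_of_zero_le hpos.le
  have hm := hle hx
  rw [Int.natAbs_natCast] at hm
  -- Positivity spreads from one positive value m upwards and downwards, since consecutive values
  -- have equal signs.
  have hup : ∀ k, m ≤ k → k ≤ n → (k : ℤ) ∈ α := by
    intro k hmk
    induction k, hmk using Nat.le_induction with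
    | base => exact fun _ => hx
    | succ k hmk ih =>
      intro hk
      exact (hmem (k + 1) (by omega) hk).resolve_right
        fun h' => (hstep k (by omega)).1 ⟨ih (by omega), h'⟩
  have hdown : ∀ d, d < m → ((m - d : ℕ) : ℤ) ∈ α := by
    intro d
    induction d with
    | zero => exact fun _ => hx
    | succ d ih =>
      intro hd
      refine (hmem (m - (d + 1)) (by omega) (by omega)).resolve_right
        fun h' => (hstep (m - (d + 1)) (by omega)).2 ⟨h', ?_⟩
      rw [show m - (d + 1) + 1 = m - d by omega]
      exact ih (by omega)
  intro y hy
  by_contra hneg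
  obtain ⟨h1, h2⟩ := hle hy
  have hy' : y = -(y.natAbs : ℤ) := by omega
  refine hnd y.natAbs h1 ⟨?_, hy' ▸ hy⟩
  rcases le_total m y.natAbs with hc | hc
  · exact hup _ hc h2
  · have := hdown (m - y.natAbs) (by omega)
    rwa [Nat.sub_sub_self hc] at this

/-! ### Fixed points of cds -/

section Slices

variable {T : Type*} {l : List T} {a b c d i : ℕ} {x : T}

theorem eq_append_slices (l : List T) (hab : a ≤ b) (hbc : b ≤ c) (hcd : c ≤ d) :
    l = l.take a ++ (l.take b).drop a ++ (l.take c).drop b ++ (l.take d).drop c ++ l.drop d := by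
  have h {a b : ℕ} (hab : a ≤ b) : l.take a ++ (l.take b).drop a = l.take b := by
    conv_rhs => rw [← List.take_append_drop a (l.take b), List.take_take, min_eq_left hab]
  rw [h hab, h hbc, h hcd, List.take_append_drop]

theorem head?_slice (hx : l[a]? = some x) (hab : a < b) :
    ((l.take b).drop a).head? = some x := by
  rw [List.head?_drop, List.getElem?_take_of_lt hab, hx]

theorem getLast?_slice (hx : l[i]? = some x) (hai : a ≤ i) :
    ((l.take (i + 1)).drop a).getLast? = some x := by
  have hi := (List.getElem?_eq_some_iff.1 hx).1
  rw [List.getLast?_drop, if_neg, List.getLast?_take]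
  · simp [hx]
  · rw [List.length_take]
    omega

theorem getLast?_take_succ (hx : l[i]? = some x) : (l.take (i + 1)).getLast? = some x :=
  getLast?_slice (a := 0) hx (Nat.zero_le i)

end Slices

section Swaps

variable {δ : List ℤ} {x x' y y' : ℤ} {i i' j j' : ℕ}

/-- This and the next three lemmas treat the ways in which the first p and the first q can stand
left or right of their entries. A cut at a right pointer falls after its entry, whence the + 1; a
weak inequality allows one entry to carry both pointers. -/
theorem exists_cdsStep_left_right (hx : δ[i]? = some x) (hx' : δ[i']? = some x')
    (hy : δ[j]? = some y) (hy' : δ[j']? = some y') (hp : rightPtr x = leftPtr x')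
    (hq : rightPtr y = leftPtr y') (h₁ : i' ≤ j) (h₂ : j < i) (h₃ : i < j') :
    ∃ ε, CdsStep δ ε := by
  have hδ := eq_append_slices δ (a := i') (b := j + 1) (c := i + 1) (d := j') (by omega)
    (by omega) (by omega)
  obtain ⟨M, hM⟩ := List.getLast?_eq_some_iff.1 (getLast?_slice (a := j + 1) hx (by omega))
  obtain ⟨C, hC⟩ := List.head?_eq_some_iff.1 ((List.head?_drop (l := δ) (i := j')).trans hy')
  rw [hM, hC] at hδ
  rw [hδ]
  exact ⟨_, _, _, CdsAt.case1 _ _ M _ C x x' y y' (head?_slice hx' (by omega))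
    (getLast?_slice hy h₁) rfl hp.symm rfl hq.symm⟩

theorem exists_cdsStep_right_right (hx : δ[i]? = some x) (hx' : δ[i']? = some x')
    (hy : δ[j]? = some y) (hy' : δ[j']? = some y') (hp : rightPtr x = leftPtr x')
    (hq : rightPtr y = leftPtr y') (h₁ : i < j) (h₂ : j < i') (h₃ : i' < j') :
    ∃ ε, CdsStep δ ε := by
  have hδ := eq_append_slices δ (a := i + 1) (b := j + 1) (c := i') (d := j') (by omega)
    (by omega) (by omega)
  obtain ⟨A, hA⟩ := List.getLast?_eq_some_iff.1 (getLast?_take_succ hx)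
  obtain ⟨C, hC⟩ := List.head?_eq_some_iff.1 ((List.head?_drop (l := δ) (i := j')).trans hy')
  rw [hA, hC] at hδ
  rw [hδ]
  exact ⟨_, _, _, CdsAt.case2 A _ _ _ C x x' y y' (getLast?_slice hy (by omega))
    (head?_slice hx' (by omega)) rfl hp.symm rfl hq.symm⟩

theorem exists_cdsStep_right_left (hx : δ[i]? = some x) (hx' : δ[i']? = some x')
    (hy : δ[j]? = some y) (hy' : δ[j']? = some y') (hp : rightPtr x = leftPtr x')
    (hq : rightPtr y = leftPtr y') (h₁ : i < j') (h₂ : j' < i') (h₃ : i' ≤ j) :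
    ∃ ε, CdsStep δ ε := by
  have hδ := eq_append_slices δ (a := i + 1) (b := j') (c := i') (d := j + 1) (by omega)
    (by omega) (by omega)
  obtain ⟨A, hA⟩ := List.getLast?_eq_some_iff.1 (getLast?_take_succ hx)
  obtain ⟨M, hM⟩ := List.head?_eq_some_iff.1 (head?_slice (b := i') hy' (by omega))
  rw [hA, hM] at hδ
  rw [hδ]
  exact ⟨_, _, _, CdsAt.case3 A _ M _ _ x x' y y' (head?_slice hx' (by omega))
    (getLast?_slice hy (by omega)) rfl hp.symm rfl hq.symm⟩

theorem exists_cdsStep_left_left (hx : δ[i]? = some x) (hx' : δ[i']? = some x')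
    (hy : δ[j]? = some y) (hy' : δ[j']? = some y') (hp : rightPtr x = leftPtr x')
    (hq : rightPtr y = leftPtr y') (h₁ : i' < j') (h₂ : j' ≤ i) (h₃ : i < j) :
    ∃ ε, CdsStep δ ε := by
  have hδ := eq_append_slices δ (a := i') (b := j') (c := i + 1) (d := j + 1) (by omega)
    (by omega) (by omega)
  rw [hδ]
  exact ⟨_, _, _, CdsAt.case4 _ _ _ _ _ x x' y y' (head?_slice hx' (by omega))
    (head?_slice hy' (by omega)) (getLast?_slice hx (by omega)) (getLast?_slice hy (by omega))
    rfl hp.symm rfl hq.symm⟩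

end Swaps

/-- Values `1, …, n` at positions such that no two adjacencies `k, k + 1` and `v, v + 1`
interlock are arranged as a rotation of `1, …, n`. -/
theorem pos_rotation {n : ℕ} {pos : ℕ → ℕ}
    (hinj : ∀ v w, 1 ≤ v → v ≤ n → 1 ≤ w → w ≤ n → pos v = pos w → v = w)
    (hlt : ∀ v, 1 ≤ v → v ≤ n → pos v < n)
    (hsurj : ∀ i, i < n → ∃ v, 1 ≤ v ∧ v ≤ n ∧ pos v = i)
    (h₁ : ∀ k v, 1 ≤ k → k < n → 1 ≤ v → v < n →
      ¬ (pos (k + 1) ≤ pos v ∧ pos v < pos k ∧ pos k < pos (v + 1)))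
    (h₂ : ∀ k v, 1 ≤ k → k < n → 1 ≤ v → v < n →
      ¬ (pos k < pos v ∧ pos v < pos (k + 1) ∧ pos (k + 1) < pos (v + 1)))
    (h₃ : ∀ k v, 1 ≤ k → k < n → 1 ≤ v → v < n →
      ¬ (pos k < pos (v + 1) ∧ pos (v + 1) < pos (k + 1) ∧ pos (k + 1) ≤ pos v))
    (h₄ : ∀ k v, 1 ≤ k → k < n → 1 ≤ v → v < n →
      ¬ (pos (k + 1) < pos (v + 1) ∧ pos (v + 1) ≤ pos k ∧ pos k < pos v)) :
    (∀ v, 1 ≤ v → v ≤ n → pos v + 1 = v) ∨ (1 ≤ n ∧ pos 1 = pos n + 1) := by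
  have connected (S : ℕ → Prop) (w : ℕ) (hw1 : 1 ≤ w) (hwn : w ≤ n) (hw : S w)
      (hup : ∀ v, w ≤ v → v < n → S v → S (v + 1))
      (hdown : ∀ v, 1 ≤ v → v < w → S (v + 1) → S v) : ∀ v, 1 ≤ v → v ≤ n → S v := by
    intro v hv1 hvn
    rcases le_total w v with h | h
    · induction v, h using Nat.le_induction with
      | base => exact hw
      | succ v hv ih => exact hup v hv (by omega) (ih (by omega) (by omega))
    · exact Nat.decreasingInduction' (P := S) (fun u hu hvu => hdown u (by omega) hu) h hw
  have hne (v w : ℕ) (hv : 1 ≤ v) (hvn : v ≤ n) (hw : 1 ≤ w) (hwn : w ≤ n) (hvw : v ≠ w) :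
      pos v ≠ pos w := fun h => hvw (hinj v w hv hvn hw hwn h)
  -- An ascent is tight: the values placed strictly between k and k + 1 are closed under successor
  -- and predecessor, as otherwise two adjacencies would interlock. If there were any, k would be
  -- one of them.
  have hA (k : ℕ) (hk : 1 ≤ k) (hkn : k < n) (h : pos k < pos (k + 1)) :
      pos (k + 1) = pos k + 1 := by
    by_contra hcon
    have := hlt (k + 1) (by omega) (by omega)
    obtain ⟨w, hw1, hwn, hw⟩ := hsurj (pos k + 1) (by omega)
    have := connected (fun v => pos k < pos v ∧ pos v < pos (k + 1)) w hw1 hwn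
      ⟨by omega, by omega⟩ ?_ ?_ k hk hkn.le
    · omega
    · rintro v hv hvn ⟨ha, hb⟩
      have := h₂ k v hk hkn (by omega) hvn
      have := h₁ v k (by omega) hvn hk hkn
      have : v + 1 ≠ k + 1 := by
        rintro h
        obtain rfl : v = k := by omega
        omega
      have := hne (v + 1) (k + 1) (by omega) (by omega) (by omega) (by omega) this
      omega
    · rintro v hv hvw ⟨ha, hb⟩
      have hvk : v ≠ k := by rintro rfl; omega
      have := hne v k (by omega) (by omega) (by omega) (by omega) hvk
      have := h₃ k v hk hkn hv (by omega)
      have := h₂ v k hv (by omega) hk hkn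
      omega
  -- A descent spans the whole list: the values placed from k + 1 to k, ends included, are likewise
  -- closed under both moves and contain k, hence are all values.
  have hB (k : ℕ) (hk : 1 ≤ k) (hkn : k < n) (h : pos (k + 1) < pos k) :
      pos (k + 1) = 0 ∧ pos n ≤ pos k := by
    have hall : ∀ v, 1 ≤ v → v ≤ n → pos (k + 1) ≤ pos v ∧ pos v ≤ pos k := by
      have hu : ∀ v, 1 ≤ v → v < n → v ≠ k → pos (k + 1) ≤ pos v ∧ pos v ≤ pos k →
          pos (k + 1) ≤ pos (v + 1) ∧ pos (v + 1) ≤ pos k := by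
        rintro v hv hvn hvk ⟨ha, hb⟩
        have := hne v k (by omega) (by omega) (by omega) (by omega) hvk
        have := h₁ k v hk hkn hv hvn
        have := h₄ v k hv hvn hk hkn
        omega
      have hd : ∀ v, 1 ≤ v → v < n → v ≠ k → pos (k + 1) ≤ pos (v + 1) ∧ pos (v + 1) ≤ pos k →
          pos (k + 1) ≤ pos v ∧ pos v ≤ pos k := by
        rintro v hv hvn hvk ⟨ha, hb⟩
        have := hne (v + 1) (k + 1) (by omega) (by omega) (by omega) (by omega) (by omega)
        have := h₄ k v hk hkn hv hvn
        have := h₃ v k hv hvn hk hkn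
        omega
      refine connected _ k hk hkn.le ⟨h.le, le_rfl⟩ (fun v hv hvn hS => ?_)
        fun v hv hvk hS => hd v hv (by omega) (by omega) hS
      by_cases hvk : v = k
      · subst hvk
        exact ⟨le_rfl, h.le⟩
      · exact hu v (by omega) hvn hvk hS
    have := hlt k hk hkn.le
    obtain ⟨w, hw1, hwn, hw⟩ := hsurj 0 (by omega)
    have := hall w hw1 hwn
    exact ⟨by omega, (hall n (by omega) le_rfl).2⟩
  by_cases hex : ∃ k, 1 ≤ k ∧ k < n ∧ pos (k + 1) < pos k
  · right
    obtain ⟨k, hk, hkn, h⟩ := hex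
    obtain ⟨hk0, hnk⟩ := hB k hk hkn h
    refine ⟨by omega, ?_⟩
    have hn : pos n + 1 < n := by
      have := hne n k (by omega) le_rfl hk hkn.le (by omega)
      have := hlt k hk hkn.le
      omega
    -- If the value z after n were not 1, consider z - 1: an ascent to z would put z - 1 at the
    -- position of n, and a descent would put z at position 0.
    obtain ⟨z, hz1, hzn, hz⟩ := hsurj (pos n + 1) hn
    by_contra hcon
    have hz' : z ≠ 1 := by rintro rfl; exact hcon hz
    obtain ⟨u, rfl⟩ : ∃ u, z = u + 1 := ⟨z - 1, by omega⟩
    rcases lt_trichotomy (pos u) (pos (u + 1)) with hc | hc | hc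
    · have := hA u (by omega) (by omega) hc
      have := hinj u n (by omega) (by omega) (by omega) le_rfl (by omega)
      omega
    · have := hinj u (u + 1) (by omega) (by omega) (by omega) hzn hc
      omega
    · have := hB u (by omega) (by omega) hc
      omega
  · left
    push Not at hex
    have hsucc (k : ℕ) (hk : 1 ≤ k) (hkn : k < n) : pos (k + 1) = pos k + 1 :=
      hA k hk hkn ((hex k hk hkn).lt_of_ne (hne _ _ (by omega) (by omega) (by omega) (by omega)
        (by omega)))
    have hlin : ∀ v, 1 ≤ v → v ≤ n → pos v + 1 = pos 1 + v := by
      intro v hv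
      induction v, hv using Nat.le_induction with
      | base => omega
      | succ v hv ih =>
        intro hvn
        have := hsucc v hv (by omega)
        have := ih (by omega)
        omega
    intro v hv hvn
    have h1 := hlin v hv hvn
    have h2 := hlin n (by omega) le_rfl
    have h3 := hlt n (by omega) le_rfl
    omega

theorem Oriented.eq_idPerm {n : ℕ} {δ : List ℤ} (hδ : IsSignedPerm n δ) (h : Oriented n δ)
    (hpos : ∀ x ∈ δ, 0 < x) (hfix : IsFixedPoint CdsStep δ) : δ = idPerm n := by
  have hmap : (δ.map Int.natAbs).map (fun k : ℕ => (k : ℤ)) = δ := by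
    rw [List.map_map]
    conv_rhs => rw [← List.map_id δ]
    refine List.map_congr_left fun a ha => ?_
    have := hpos a ha
    simp only [Function.comp_apply, id_eq]
    omega
  have hlen : (δ.map Int.natAbs).length = n := by rw [hδ.length_eq, List.length_range']
  set l := δ.map Int.natAbs with hl
  have hmem (v : ℕ) (h1 : 1 ≤ v) (h2 : v ≤ n) : v ∈ l := by
    rw [hδ.mem_iff, List.mem_range'_1]
    omega
  have hget (v : ℕ) (h1 : 1 ≤ v) (h2 : v ≤ n) : δ[l.idxOf v]? = some (v : ℤ) := by
    rw [← hmap, List.getElem?_map, List.getElem?_idxOf (hmem v h1 h2)]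
    rfl
  have hlt (v : ℕ) (h1 : 1 ≤ v) (h2 : v ≤ n) : l.idxOf v < n := by
    have := List.idxOf_lt_length_of_mem (hmem v h1 h2)
    omega
  have hptr (k : ℕ) (hk : 1 ≤ k) : rightPtr (k : ℤ) = leftPtr ((k + 1 : ℕ) : ℤ) := by
    obtain ⟨m, rfl⟩ : ∃ m, k = m + 1 := ⟨k - 1, by omega⟩
    rw [rightPtr_natCast_succ, leftPtr_natCast_succ]
  have hno : ¬ ∃ ε, CdsStep δ ε := fun ⟨ε, hε⟩ => hfix ε hε
  rcases pos_rotation (n := n) (pos := fun v => l.idxOf v)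
    (fun v w hv hvn _ _ he => (List.idxOf_inj (hmem v hv hvn)).1 he) hlt
    (fun i hi => by
      have hi' : i < l.length := by omega
      have hm := hδ.subset (List.getElem_mem hi')
      rw [List.mem_range'_1] at hm
      exact ⟨l[i], hm.1, by omega, (hδ.nodup_iff.2 List.nodup_range').idxOf_getElem i hi'⟩)
    (fun k v hk hkn hv hvn ⟨ha, hb, hc⟩ => hno <| exists_cdsStep_left_right
      (hget k hk hkn.le) (hget (k + 1) (by omega) hkn) (hget v hv hvn.le)
      (hget (v + 1) (by omega) hvn) (hptr k hk) (hptr v hv) ha hb hc)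
    (fun k v hk hkn hv hvn ⟨ha, hb, hc⟩ => hno <| exists_cdsStep_right_right
      (hget k hk hkn.le) (hget (k + 1) (by omega) hkn) (hget v hv hvn.le)
      (hget (v + 1) (by omega) hvn) (hptr k hk) (hptr v hv) ha hb hc)
    (fun k v hk hkn hv hvn ⟨ha, hb, hc⟩ => hno <| exists_cdsStep_right_left
      (hget k hk hkn.le) (hget (k + 1) (by omega) hkn) (hget v hv hvn.le)
      (hget (v + 1) (by omega) hvn) (hptr k hk) (hptr v hv) ha hb hc)
    (fun k v hk hkn hv hvn ⟨ha, hb, hc⟩ => hno <| exists_cdsStep_left_left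
      (hget k hk hkn.le) (hget (k + 1) (by omega) hkn) (hget v hv hvn.le)
      (hget (v + 1) (by omega) hvn) (hptr k hk) (hptr v hv) ha hb hc) with hr | ⟨hn, hr⟩
  · have hl' : l = List.range' 1 n := by
      refine List.ext_getElem (by rw [hlen, List.length_range']) fun i hi hi' => ?_
      have hm := hδ.subset (List.getElem_mem hi)
      rw [List.mem_range'_1] at hm
      have := hr l[i] hm.1 (by omega)
      rw [(hδ.nodup_iff.2 List.nodup_range').idxOf_getElem i hi] at this
      rw [List.getElem_range', ← this]
      omega
    rw [← hmap, hl', idPerm]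
  -- The gap between n and the following 1 is an edge joining (n, n + 1) to (0, 1).
  · exfalso
    obtain ⟨-, f, hf, hne⟩ := h
    obtain ⟨m, rfl⟩ : ∃ m, n = m + 1 := ⟨n - 1, by omega⟩
    have h1 := hget 1 le_rfl hn
    have h2 := hget (m + 1) hn le_rfl
    rw [hr] at h1
    obtain ⟨C, hC⟩ := List.head?_eq_some_iff.1 (List.head?_drop.trans h1)
    obtain ⟨A, hA⟩ := List.getLast?_eq_some_iff.1 (getLast?_take_succ h2)
    rw [openGaps, ← List.take_append_drop (l.idxOf (m + 1) + 1) δ, hA, hC, gaps_append_cons,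
      gaps_append_cons, mem_constOn_add, mem_constOn_add, gaps, ← Multiset.cons_zero,
      mem_constOn_cons, rightPtr_natCast_succ] at hf
    exact hne hf.1.2.1.symm

/-! ### Sequences of steps: invariants, counting and termination -/

theorem Steps.rec_invariant {R : List ℤ → List ℤ → Prop} {S : List ℤ → Prop}
    (hR : ∀ α β, S α → R α β → S β) {k : ℕ} {α β : List ℤ} (h : Steps R k α β) (hα : S α) :
    S β := by
  induction h with
  | zero => exact hα
  | succ _ hstep ih => exact hR _ _ (ih hα) hstep

theorem Steps.add_mul_eq {R : List ℤ → List ℤ → Prop} {S : List ℤ → Prop} {c : ℕ}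
    {μ : List ℤ → ℕ} (hS : ∀ α β, S α → R α β → S β)
    (hμ : ∀ α β, S α → R α β → μ β = μ α + c) {k : ℕ} {α β : List ℤ} (h : Steps R k α β)
    (hα : S α) : μ β = μ α + c * k := by
  induction h with
  | zero => rfl
  | succ h hstep ih => rw [hμ _ _ (h.rec_invariant hS hα) hstep, ih hα, mul_add, mul_one, add_assoc]

theorem Steps.numComponents_cdr {n k : ℕ} {α β : List ℤ} (h : Steps CdrStep k α β)
    (hα : IsSignedPerm n α) : numComponents (pointers n) (closedGaps n β) =
      numComponents (pointers n) (closedGaps n α) + 1 * k :=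
  h.add_mul_eq (S := IsSignedPerm n) (c := 1)
    (μ := fun α => numComponents (pointers n) (closedGaps n α))
    (fun _ _ hS hs => hS.of_cdrStep hs) (fun _ _ hS hs => hS.numComponents_of_cdrStep hs) hα

theorem Steps.numComponents_cds {n k : ℕ} {α β : List ℤ} (h : Steps CdsStep k α β)
    (hα : IsSignedPerm n α) : numComponents (pointers n) (closedGaps n β) =
      numComponents (pointers n) (closedGaps n α) + 2 * k :=
  h.add_mul_eq (S := IsSignedPerm n) (c := 2)
    (μ := fun α => numComponents (pointers n) (closedGaps n α))
    (fun _ _ hS hs => hS.of_cdsStep hs) (fun _ _ hS hs => hS.numComponents_of_cdsStep hs) hα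

theorem terminates_of_bounded {R : List ℤ → List ℤ → Prop} {S : List ℤ → Prop} {μ : List ℤ → ℕ}
    {b : ℕ} (hS : ∀ α β, S α → R α β → S β) (hμ : ∀ α β, S α → R α β → μ α < μ β)
    (hb : ∀ α, μ α ≤ b) {α : List ℤ} (hα : S α) : Terminates R α := by
  rintro ⟨f, hf, hstep⟩
  have hSf : ∀ i, S (f i) := by
    intro i
    induction i with
    | zero => exact hf ▸ hα
    | succ i ih => exact hS _ _ ih (hstep i)
  have hmono : StrictMono fun i => μ (f i) := strictMono_nat_of_lt_succ fun i =>
    hμ _ _ (hSf i) (hstep i)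
  have := hmono.le_apply (x := b + 1)
  have := hb (f (b + 1))
  omega

end ContextDirected

open ContextDirected in
theorem theorem10 (n : ℕ) (π : List ℤ) (hπ : ContextDirected.IsSignedPerm n π)
    (hsort : ContextDirected.CdrSortable n π) :
    -- the steps theorem, for all `k`, `m` and all cdr fixed points `β` of `π`
    (∀ (k m : ℕ) (β : List ℤ),
      ContextDirected.Steps ContextDirected.CdrStep k π β →
      ContextDirected.IsFixedPoint ContextDirected.CdrStep β →
      ContextDirected.Steps ContextDirected.CdsStep m β (ContextDirected.idPerm n) →
      ContextDirected.Steps ContextDirected.CdrStep (k + 2 * m) π (ContextDirected.idPerm n) ∧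
      ∀ N : ℕ, ContextDirected.Steps ContextDirected.CdrStep N π (ContextDirected.idPerm n) →
        N = k + 2 * m) ∧
    -- such `k`, `β`, `m` are found by indiscriminate applications of cdr, then of cds
    ContextDirected.Terminates ContextDirected.CdrStep π ∧
    (∀ (k : ℕ) (β : List ℤ),
      ContextDirected.Steps ContextDirected.CdrStep k π β →
      ContextDirected.IsFixedPoint ContextDirected.CdrStep β →
      ContextDirected.Terminates ContextDirected.CdsStep β ∧
      ∀ (m : ℕ) (δ : List ℤ),
        ContextDirected.Steps ContextDirected.CdsStep m β δ →
        ContextDirected.IsFixedPoint ContextDirected.CdsStep δ →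
        δ = ContextDirected.idPerm n) := by
  have cdr_perm {k : ℕ} {β : List ℤ} (h : Steps CdrStep k π β) : IsSignedPerm n β :=
    h.rec_invariant (S := IsSignedPerm n) (fun _ _ hS hs => hS.of_cdrStep hs) hπ
  refine ⟨fun k m β hk _ hm => ?_, ?_, fun k β hk hfix => ⟨?_, fun m δ hm hδ => ?_⟩⟩
  · have huniq (N : ℕ) (hN : Steps CdrStep N π (idPerm n)) : N = k + 2 * m := by
      have h1 := hN.numComponents_cdr hπ
      have h2 := hk.numComponents_cdr hπ
      have h3 := hm.numComponents_cds (cdr_perm hk)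
      omega
    -- Sortability supplies a sorting sequence of some length, and uniqueness identifies that length
    -- as k + 2m.
    obtain ⟨N, hN⟩ := hsort
    have hNk := huniq N hN
    subst hNk
    exact ⟨hN, huniq⟩
  · exact terminates_of_bounded (S := IsSignedPerm n) (fun _ _ hS hs => hS.of_cdrStep hs)
      (μ := fun α => numComponents (pointers n) (closedGaps n α))
      (fun _ _ hα hs => by rw [hα.numComponents_of_cdrStep hs]; omega)
      (fun α => numComponents_le (pointers n) (closedGaps n α)) hπ
  · exact terminates_of_bounded (S := IsSignedPerm n) (fun _ _ hS hs => hS.of_cdsStep hs)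
      (μ := fun α => numComponents (pointers n) (closedGaps n α))
      (fun _ _ hα hs => by rw [hα.numComponents_of_cdsStep hs]; omega)
      (fun α => numComponents_le (pointers n) (closedGaps n α)) (cdr_perm hk)
  · have hβ := cdr_perm hk
    have hδ' : IsSignedPerm n δ :=
      hm.rec_invariant (S := IsSignedPerm n) (fun _ _ hS hs => hS.of_cdsStep hs) hβ
    -- For n = 0 the pointers (0, 1) and (n, n + 1) coincide, so nothing is oriented and the case is
    -- settled by hand.
    rcases Nat.eq_zero_or_pos n with rfl | hn
    · have : δ.map Int.natAbs = [] := List.perm_nil.1 hδ'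
      rw [List.map_eq_nil_iff.1 this]
      rfl
    have cdr_oriented {k : ℕ} {α β : List ℤ} (h : Steps CdrStep k α β) (hα : IsSignedPerm n α) :
        Oriented n β ↔ Oriented n α :=
      (h.rec_invariant (S := fun β => IsSignedPerm n β ∧ (Oriented n β ↔ Oriented n α))
        (fun _ _ hS hs => ⟨hS.1.of_cdrStep hs, (hS.1.oriented_iff_of_cdrStep hs).trans hS.2⟩)
        ⟨hα, Iff.rfl⟩).2
    -- Orientation passes from the identity back to π along a sorting sequence, and then forward to
    -- β.
    have hβo : Oriented n β := by
      obtain ⟨N, hN⟩ := hsort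
      exact (cdr_oriented hk hπ).2 ((cdr_oriented hN hπ).1 (oriented_idPerm hn))
    obtain ⟨-, hδo, hδp⟩ := hm.rec_invariant
      (S := fun δ => IsSignedPerm n δ ∧ Oriented n δ ∧ ∀ x ∈ δ, 0 < x)
      (fun _ _ hS hs => ⟨hS.1.of_cdsStep hs, (hS.1.oriented_iff_of_cdsStep hs).2 hS.2.1, by
        obtain ⟨p, q, hpq⟩ := hs
        exact fun x hx => hS.2.2 x (hpq.perm.mem_iff.2 hx)⟩)
      ⟨hβ, hβo, hβo.pos_of_isFixedPoint hβ hfix⟩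
    exact hδo.eq_idPerm hδ' hδp hδ
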